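/- Let $A$ be a non-empty set, let $1\le p<\infty$, and let $\ell_p(A)$ be the real Banach lattice of families $(\lambda_a)_{a\in A}$ with $\sum_a|\lambda_a|^p<\infty$, with the coordinatewise order. For $a\in A$ and $B\subseteq A$ finite let $e_a$ and $\chi_B$ be the characteristic functions of $\{a\}$ and $B$. The regular operators on $X=\ell_p(A)$ (differences of two positive linear operators), ordered by $S\le T$ iff $T-S$ is positive, form a Dedekind complete vector lattice, in which the center $\mathcal Z(X)=\{T:\ \pm T\le c\,\mathrm{id}_X\text{ for some }c>0\}$ is a projection band; a regular operator $T$ has constant diagonal $\alpha$ if the band projection $\mathcal D$ onto $\mathcal Z(X)$ satisfies $\mathcal D(T)=\alpha\,\mathrm{id}_X$. Let $P\colon\ell_p(A)\to\ell_p(A)$ be a contractive ($\|Px\|\le\|x\|$ for all $x$) positive linear projection with constant diagonal $\alpha>0$. Then $n=1/\alpha$ is a natural number, and there is a partition $\{A_i\}_i$ of $A$ into sets of size $n$ such that $$P\Big(\sum_{a\in A}\lambda_a e_a\Big)=\alpha\sum_i\Big(\sum_{a\in A_i}\lambda_a\Big)\chi_{A_i}$$ whenever $\sum_{a\in A}|\lambda_a|^p<\infty$,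 the sum over $i$ converging unconditionally in $\ell_p(A)$. In particular, if $A$ is countable (finite or infinite), there is an enumeration of $A$ for which the matrix of $P$ is block-diagonal, all diagonal blocks being $\alpha\mathbf 1_n$, where $\mathbf 1_n$ is the $n\times n$ matrix of ones, and all other blocks being zero; if $A$ is finite, its cardinality is a multiple of $n$ and there are finitely many blocks. -/

import Mathlib

open scoped ENNReal

set_option linter.unusedSectionVars false

noncomputable section

namespace PosProj

/-! ### Regular and central operators on an ordered vector space -/

section Operators

variable {X : Type*} [AddCommGroup X] [PartialOrder X] [IsOrderedAddMonoid X]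
  [Module ℝ X] [IsOrderedModule ℝ X]

/-- A linear operator is positive if it maps positive vectors to positive vectors. -/
def IsPositiveOp (T : X →ₗ[ℝ] X) : Prop := ∀ x : X, 0 ≤ x → 0 ≤ T x

theorem IsPositiveOp.add {S T : X →ₗ[ℝ] X} (hS : IsPositiveOp S) (hT : IsPositiveOp T) :
    IsPositiveOp (S + T) := fun x hx => add_nonneg (hS x hx) (hT x hx)

theorem IsPositiveOp.smul {c : ℝ} (hc : 0 ≤ c) {T : X →ₗ[ℝ] X} (hT : IsPositiveOp T) :
    IsPositiveOp (c • T) := fun x hx => smul_nonneg hc (hT x hx)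

theorem isPositiveOp_zero : IsPositiveOp (0 : X →ₗ[ℝ] X) := fun _ _ => le_rfl

theorem isPositiveOp_id : IsPositiveOp (LinearMap.id : X →ₗ[ℝ] X) := fun _ hx => hx

variable (X) in
/-- The space of regular operators on `X`: differences of two positive operators. -/
def regularOps : Submodule ℝ (X →ₗ[ℝ] X) where
  carrier := {T | ∃ U V : X →ₗ[ℝ] X, IsPositiveOp U ∧ IsPositiveOp V ∧ T = U - V}
  zero_mem' := ⟨0, 0, isPositiveOp_zero, isPositiveOp_zero, by simp⟩
  add_mem' := by
    rintro _ _ ⟨U, V, hU, hV, rfl⟩ ⟨U', V', hU', hV', rfl⟩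
    exact ⟨U + U', V + V', hU.add hU', hV.add hV', by abel⟩
  smul_mem' := by
    rintro c _ ⟨U, V, hU, hV, rfl⟩
    rcases le_total 0 c with hc | hc
    · exact ⟨c • U, c • V, hU.smul hc, hV.smul hc, smul_sub c U V⟩
    · refine ⟨(-c) • V, (-c) • U, hV.smul (neg_nonneg.2 hc), hU.smul (neg_nonneg.2 hc), ?_⟩
      rw [smul_sub, neg_smul, neg_smul]
      abel

variable (X) in
/-- The type of regular operators, ordered by `S ≤ T` iff `T - S` is positive. -/
def RegularOp : Type _ := regularOps X

instance : AddCommGroup (RegularOp X) := inferInstanceAs (AddCommGroup (regularOps X))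

instance : Module ℝ (RegularOp X) := inferInstanceAs (Module ℝ (regularOps X))

instance : Preorder (RegularOp X) where
  le S T := ∀ x : X, 0 ≤ x → S.1 x ≤ T.1 x
  le_refl _ _ _ := le_rfl
  le_trans _ _ _ h₁ h₂ x hx := (h₁ x hx).trans (h₂ x hx)

variable (X) in
/-- The identity operator as a regular operator. -/
def RegularOp.id : RegularOp X :=
  ⟨LinearMap.id, LinearMap.id, 0, isPositiveOp_id, isPositiveOp_zero, by simp⟩

/-- `T` is central if `±T ≤ c · id` for some `c > 0`. -/
def IsCentral (T : RegularOp X) : Prop :=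
  ∃ c : ℝ, 0 < c ∧ T ≤ c • RegularOp.id X ∧ -T ≤ c • RegularOp.id X

/-- `S` and `T` are disjoint, `|S| ∧ |T| = 0`, where `|S| = S ∨ (-S)`; suprema and infima are
those of the space of regular operators. -/
def DisjointOps (S T : RegularOp X) : Prop :=
  ∃ s t : RegularOp X, IsLUB {S, -S} s ∧ IsLUB {T, -T} t ∧ IsGLB {s, t} 0

/-- `S` is the image of `T` under the band projection of the space of regular operators onto the
center: `S` lies in the center and `T - S` in its disjoint complement. -/
def IsDiagonalOf (S T : RegularOp X) : Prop :=
  IsCentral S ∧ ∀ C : RegularOp X, IsCentral C → DisjointOps (T - S) C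

/-- The operator `T` is regular and has constant diagonal `α`: its projection onto the center is
`α · id`. -/
def HasConstantDiagonal (T : X →ₗ[ℝ] X) (α : ℝ) : Prop :=
  ∃ hT : T ∈ regularOps X, IsDiagonalOf (α • RegularOp.id X) (⟨T, hT⟩ : RegularOp X)

end Operators

/-! ### The real space `ℓ_p(A)` with its coordinatewise order -/

section Lp

variable {A : Type*} {p : ℝ≥0∞}

/-- The real space `ℓ_p(A)`. -/
abbrev ellp (A : Type*) (p : ℝ≥0∞) := lp (fun _ : A => ℝ) p

instance : PartialOrder (ellp A p) where
  le x y := ∀ a, x a ≤ y a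
  le_refl _ _ := le_rfl
  le_trans _ _ _ h₁ h₂ a := (h₁ a).trans (h₂ a)
  le_antisymm _ _ h₁ h₂ := lp.ext (funext fun a => le_antisymm (h₁ a) (h₂ a))

instance : IsOrderedAddMonoid (ellp A p) where
  add_le_add_left _ _ h z a := add_le_add_left (h a) (z a)

instance : IsOrderedModule ℝ (ellp A p) where
  smul_le_smul_of_nonneg_left _ hc _ _ h a := mul_le_mul_of_nonneg_left (h a) hc
  smul_le_smul_of_nonneg_right _ hx _ _ h a := mul_le_mul_of_nonneg_right h (hx a)

open Classical in
/-- `e_a`, the characteristic function of `{a}`, in `ℓ_p(A)`. -/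
def unitVec (p : ℝ≥0∞) (a : A) : ellp A p := lp.single p a (1 : ℝ)

/-- The characteristic function of a finite set `B ⊆ A`, in `ℓ_p(A)`. -/
def charFun (p : ℝ≥0∞) (B : Finset A) : ellp A p := ∑ a ∈ B, unitVec p a

/-- The matrix of an operator on `ℓ_p(A)` with respect to an enumeration `e` of `A`: column `k`
holds the coordinates of the image of the `k`-th unit vector. -/
def matrixOf {J : Type*} (P : ellp A p →ₗ[ℝ] ellp A p) (e : J ≃ A) : Matrix J J ℝ :=
  Matrix.of fun j k => P (unitVec p (e k)) (e j)

end Lp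

end PosProj

end

/-! Write `P_ab` for the coefficient of `P e_b` at `a`. Disjointness of `P - α id` from the identity
gives `P_aa = α`. The key fact is that the fixed space of `P` is a sublattice: if `P x = x`, then
`|x| ≤ P |x|`, and since `P` is contractive and the norm is strictly monotone on the positive cone,
equality holds. A fixed combination of the columns `a` and `b` that vanishes at `b` must then vanish
at `a` whenever `P_ba > 0`, which yields `P_ab P_ba = α²` (`apply_unitVec_mul_apply_unitVec`). So
`P_ab > 0` is a symmetric relation; with `P² = P` it is an equivalence, and the diagonal of `P² = P`
gives each class `n = 1/α` elements. On a class, contractivity applied to the characteristic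
function bounds the sum of all entries by `n`, while the arithmetic-geometric inequality on `P_ab +
P_ba` bounds it below by `n² α = n`. Equality forces every entry to be `α`. -/

namespace PosProj

/-! ### Coordinates, strict monotonicity of the norm, and the diagonal -/

section Coordinates

variable {A : Type*} {p : ℝ≥0∞}

open Classical in
theorem unitVec_apply (a b : A) : unitVec p a b = if b = a then 1 else 0 := by
  unfold unitVec
  rw [lp.single_apply, Pi.single_apply]

open Classical in
theorem sum_smul_unitVec_apply (F : Finset A) (f : A → ℝ) (c : A) :
    (∑ a ∈ F, f a • unitVec p a : ellp A p) c = if c ∈ F then f c else 0 := by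
  rw [lp.coeFn_sum, Finset.sum_apply]
  simp [unitVec_apply]

open Classical in
theorem charFun_apply (F : Finset A) (c : A) : charFun p F c = if c ∈ F then 1 else 0 := by
  have := sum_smul_unitVec_apply (p := p) F (fun _ => 1) c
  simpa [charFun] using this

theorem unitVec_nonneg (a : A) : 0 ≤ unitVec p a := by
  classical
  intro b
  rw [unitVec_apply]
  split_ifs <;> simp

theorem charFun_nonneg (F : Finset A) : 0 ≤ charFun p F :=
  Finset.sum_nonneg fun a _ => unitVec_nonneg a

/-- A positive operator dominates its matrix sums over finite sets of columns. -/
theorem IsPositiveOp.sum_mul_le_apply {P : ellp A p →ₗ[ℝ] ellp A p} (hP : IsPositiveOp P)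
    {x : ellp A p} (hx : 0 ≤ x) (F : Finset A) (c : A) :
    ∑ a ∈ F, x a * P (unitVec p a) c ≤ P x c := by
  classical
  have h : 0 ≤ x - ∑ a ∈ F, x a • unitVec p a := by
    intro b
    have hb : 0 ≤ x b := hx b
    rw [lp.coeFn_sub, Pi.sub_apply, sum_smul_unitVec_apply]
    split_ifs
    · simp
    · simpa using hb
  have h' : 0 ≤ P (x - ∑ a ∈ F, x a • unitVec p a) c := hP _ h c
  rw [map_sub, map_sum] at h'
  simp only [map_smul, lp.coeFn_sub, Pi.sub_apply, lp.coeFn_sum, Finset.sum_apply,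
    lp.coeFn_smul, Pi.smul_apply, smul_eq_mul] at h'
  linarith

/-- A vector with finite support is mapped to a finite combination of columns. -/
theorem apply_eq_sum_mul (P : ellp A p →ₗ[ℝ] ellp A p) {x : ellp A p} {F : Finset A}
    (hx : ∀ a ∉ F, x a = 0) (c : A) : P x c = ∑ a ∈ F, x a * P (unitVec p a) c := by
  classical
  have h : x = ∑ a ∈ F, x a • unitVec p a := by
    refine lp.ext (funext fun b => ?_)
    rw [sum_smul_unitVec_apply]
    split_ifs with hb
    · rfl
    · exact hx b hb
  conv_lhs => rw [h]
  rw [map_sum, lp.coeFn_sum, Finset.sum_apply]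
  simp

/-- The pointwise absolute value of an element of `ℓ_p(A)`. -/
noncomputable def absVec (hp : 0 < p.toReal) (x : ellp A p) : ellp A p :=
  ⟨fun a => |x a|, (memℓp_gen_iff hp).2 (by simpa using (lp.memℓp x).summable hp)⟩

theorem absVec_apply (hp : 0 < p.toReal) (x : ellp A p) (a : A) : absVec hp x a = |x a| := rfl

/-- The norm of `ℓ_p(A)` is strictly monotone on the positive cone. -/
theorem eq_of_le_of_norm_le (hp : 0 < p.toReal) {x y : ellp A p} (hx : 0 ≤ x) (hxy : x ≤ y)
    (h : ‖y‖ ≤ ‖x‖) : x = y := by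
  have hx' : ∀ a, 0 ≤ x a := hx
  have hsx := lp.hasSum_norm hp x
  have hsy := lp.hasSum_norm hp y
  have hle : ∀ a, ‖x a‖ ^ p.toReal ≤ ‖y a‖ ^ p.toReal := fun a =>
    Real.rpow_le_rpow (norm_nonneg _)
      (by simpa [abs_of_nonneg (hx' a), abs_of_nonneg ((hx' a).trans (hxy a))] using hxy a) hp.le
  have h' : ‖y‖ ^ p.toReal ≤ ‖x‖ ^ p.toReal :=
    Real.rpow_le_rpow (lp.norm_nonneg' y) h hp.le
  -- One strictly larger coordinate would make the sum of `p`-th powers strictly larger.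
  refine lp.ext (funext fun a => (hxy a).antisymm (not_lt.1 fun hlt => ?_))
  have hlt' : ‖x a‖ ^ p.toReal < ‖y a‖ ^ p.toReal :=
    Real.rpow_lt_rpow (norm_nonneg _)
      (by simpa [abs_of_nonneg (hx' a), abs_of_nonneg ((hx' a).trans (hxy a))] using hlt) hp
  exact absurd (hasSum_lt hle hlt' hsx hsy) (not_lt.2 h')

theorem norm_charFun_rpow (hp : 0 < p.toReal) (F : Finset A) :
    ‖charFun p F‖ ^ p.toReal = F.card := by
  classical
  have h := lp.norm_sum_single (E := fun _ : A => ℝ) hp (fun _ => (1 : ℝ)) F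
  simp only [norm_one, Real.one_rpow, Finset.sum_const, nsmul_eq_mul, mul_one] at h
  rw [← h]
  simp only [charFun, unitVec]

/-- The coordinate projection `x ↦ x_a e_a`. -/
noncomputable def coordProj (p : ℝ≥0∞) (a : A) : ellp A p →ₗ[ℝ] ellp A p where
  toFun x := x a • unitVec p a
  map_add' x y := by rw [lp.coeFn_add, Pi.add_apply, add_smul]
  map_smul' c x := by
    rw [lp.coeFn_smul, Pi.smul_apply, smul_eq_mul, mul_smul, RingHom.id_apply]

theorem isPositiveOp_coordProj (a : A) : IsPositiveOp (coordProj p a) :=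
  fun _ hx => smul_nonneg (hx a) (unitVec_nonneg a)

theorem isCentral_id {X : Type*} [AddCommGroup X] [PartialOrder X] [IsOrderedAddMonoid X]
    [Module ℝ X] [IsOrderedModule ℝ X] : IsCentral (RegularOp.id X) := by
  refine ⟨1, one_pos, ?_, ?_⟩
  · rw [one_smul]
  · rw [one_smul]
    intro x hx
    exact (neg_nonpos.2 hx).trans hx

/-- The diagonal matrix entries of an operator with constant diagonal `α` are all `α`. -/
theorem HasConstantDiagonal.apply_unitVec_self {P : ellp A p →ₗ[ℝ] ellp A p} {α : ℝ}
    (h : HasConstantDiagonal P α) (a : A) : P (unitVec p a) a = α := by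
  classical
  obtain ⟨hT, -, hdisj⟩ := h
  obtain ⟨s, r, hs, hr, hglb⟩ := hdisj _ isCentral_id
  by_contra hne
  have hδ : 0 < |P (unitVec p a) a - α| := abs_pos.2 (sub_ne_zero.2 hne)
  have hone : unitVec p a a = 1 := by simp [unitVec_apply]
  have hs₁ := hs.1 (Set.mem_insert _ _)
  have hs₂ := hs.1 (Set.mem_insert_of_mem _ (Set.mem_singleton _))
  have hr₁ := hr.1 (Set.mem_insert _ _)
  have hspos : IsPositiveOp s.1 := by
    intro x hx c
    have h₁ : P x c - α * x c ≤ s.1 x c := hs₁ x hx c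
    have h₂ : -(P x c - α * x c) ≤ s.1 x c := hs₂ x hx c
    change (0 : ℝ) ≤ s.1 x c
    linarith
  have hsa : |P (unitVec p a) a - α| ≤ s.1 (unitVec p a) a := by
    have h₁ : P (unitVec p a) a - α * unitVec p a a ≤ s.1 (unitVec p a) a :=
      hs₁ _ (unitVec_nonneg a) a
    have h₂ : -(P (unitVec p a) a - α * unitVec p a a) ≤ s.1 (unitVec p a) a :=
      hs₂ _ (unitVec_nonneg a) a
    rw [hone, mul_one] at h₁ h₂
    exact abs_le'.2 ⟨h₁, h₂⟩
  -- The two terms put `ε • coordProj p a` below `s` and below `r ≥ id`, hence below their infimum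
  -- `0`, which fails at `e_a`.
  let ε : ℝ := min |P (unitVec p a) a - α| 1
  have hε : 0 < ε := lt_min hδ one_pos
  have hεpos : IsPositiveOp (ε • coordProj p a) := (isPositiveOp_coordProj a).smul hε.le
  let E : RegularOp (ellp A p) :=
    ⟨ε • coordProj p a, ε • coordProj p a, 0, hεpos, isPositiveOp_zero, by simp⟩
  have happ : ∀ (x : ellp A p) c, E.1 x c = ε * (x a * unitVec p a c) := fun _ _ => rfl
  have hE : E ≤ 0 := by
    refine hglb.2 ?_
    rintro T (rfl | rfl)
    · intro x hx c
      have hx' : ∀ c, 0 ≤ x c := hx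
      rw [happ, unitVec_apply]
      split_ifs with hc
      · subst hc
        have h₁ := hspos.sum_mul_le_apply hx {c} c
        rw [Finset.sum_singleton] at h₁
        rw [mul_one, mul_comm]
        exact (mul_le_mul_of_nonneg_left ((min_le_left _ _).trans hsa) (hx' c)).trans h₁
      · simpa using hspos x hx c
    · intro x hx c
      have hx' : ∀ c, 0 ≤ x c := hx
      refine le_trans ?_ (hr₁ x hx c)
      change E.1 x c ≤ x c
      rw [happ, unitVec_apply]
      split_ifs with hc
      · subst hc
        rw [mul_one]
        exact mul_le_of_le_one_left (hx' c) (min_le_right _ _)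
      · simpa using hx' c
  have := hE (unitVec p a) (unitVec_nonneg a) a
  rw [happ, hone] at this
  have h0 : ε * (1 * 1) ≤ 0 := this
  linarith

end Coordinates

/-! ### Positive contractive projections -/

section Projection

variable {A : Type*} {p : ℝ≥0∞} [Fact (1 ≤ p)] {P : ellp A p →ₗ[ℝ] ellp A p}

/-- The fixed space of a positive contraction is closed under absolute values. -/
theorem apply_absVec_of_apply_eq_self (hp : 0 < p.toReal) (hpos : IsPositiveOp P)
    (hcontr : ∀ x, ‖P x‖ ≤ ‖x‖) {x : ellp A p} (hx : P x = x) :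
    P (absVec hp x) = absVec hp x := by
  symm
  refine eq_of_le_of_norm_le hp (fun a => abs_nonneg (x a)) (fun a => ?_) (hcontr _)
  have h₁ : 0 ≤ absVec hp x - x := fun c => sub_nonneg.2 (le_abs_self (x c))
  have h₂ : 0 ≤ absVec hp x + x := fun c => neg_le_iff_add_nonneg.1 (neg_le_abs (x c))
  have h₃ : 0 ≤ P (absVec hp x - x) a := hpos _ h₁ a
  have h₄ : 0 ≤ P (absVec hp x + x) a := hpos _ h₂ a
  rw [map_sub, hx, lp.coeFn_sub, Pi.sub_apply] at h₃
  rw [map_add, hx, lp.coeFn_add, Pi.add_apply] at h₄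
  exact abs_le'.2 ⟨by linarith, by linarith⟩

/-- A nonzero matrix entry of a positive contractive projection determines the entry in the
transposed position. -/
theorem apply_unitVec_mul_apply_unitVec (hp : 0 < p.toReal) (hproj : ∀ x, P (P x) = P x)
    (hpos : IsPositiveOp P) (hcontr : ∀ x, ‖P x‖ ≤ ‖x‖) {a b : A}
    (hab : 0 < P (unitVec p a) b) :
    P (unitVec p a) b * P (unitVec p b) a = P (unitVec p a) a * P (unitVec p b) b := by
  -- A fixed vector with coefficients chosen so that it vanishes at `b`; since `|h|` is fixed too,
  -- its coordinate `0` at `b` dominates `|h a|` times a positive entry.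
  let h : ellp A p := P (unitVec p a) b • P (unitVec p b) - P (unitVec p b) b • P (unitVec p a)
  have happ : ∀ c, h c =
      P (unitVec p a) b * P (unitVec p b) c - P (unitVec p b) b * P (unitVec p a) c :=
    fun _ => rfl
  have hfix : P h = h := by simp only [h, map_sub, map_smul, hproj]
  have hk := apply_absVec_of_apply_eq_self hp hpos hcontr hfix
  have hle := hpos.sum_mul_le_apply (x := absVec hp h) (fun c => abs_nonneg (h c)) {a} b
  rw [Finset.sum_singleton, hk, absVec_apply, absVec_apply, happ b, mul_comm (P (unitVec p a) b),
    sub_self, abs_zero] at hle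
  have h0 : h a = 0 := by
    rw [← abs_eq_zero]
    exact le_antisymm (nonpos_of_mul_nonpos_left hle hab) (abs_nonneg _)
  rw [happ] at h0
  linarith

/-- The support of a column of a positive contractive projection with constant diagonal `α > 0`
is finite. -/
theorem finite_support_column (hp : 0 < p.toReal) (hproj : ∀ x, P (P x) = P x)
    (hpos : IsPositiveOp P) (hcontr : ∀ x, ‖P x‖ ≤ ‖x‖) {α : ℝ} (hα : 0 < α)
    (hdiag : ∀ a, P (unitVec p a) a = α) (b : A) : {a | 0 < P (unitVec p b) a}.Finite := by
  by_contra hinf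
  -- Each index of the support contributes `α²` to the diagonal entry `α` of `P² = P`, so there are
  -- at most `1 / α` of them.
  obtain ⟨N, hN⟩ := exists_nat_gt (1 / α)
  obtain ⟨F, hF, hcard⟩ := Set.Infinite.exists_subset_card_eq hinf N
  have hle := hpos.sum_mul_le_apply (hpos _ (unitVec_nonneg b)) F b
  rw [hproj, hdiag] at hle
  have hsum : ∑ a ∈ F, P (unitVec p b) a * P (unitVec p a) b = N * (α * α) := by
    have hterm : ∀ a ∈ F, P (unitVec p b) a * P (unitVec p a) b = α * α := by
      intro a ha
      rw [apply_unitVec_mul_apply_unitVec hp hproj hpos hcontr (hF ha), hdiag, hdiag]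
    rw [Finset.sum_congr rfl hterm, Finset.sum_const, hcard, nsmul_eq_mul]
  rw [hsum] at hle
  rw [div_lt_iff₀ hα] at hN
  nlinarith

/-- Positive contractive projections with constant diagonal `α > 0`: the matrix is `α` on the
classes of an equivalence relation, whose classes have `1 / α` elements, and zero elsewhere. -/
theorem exists_setoid_apply_unitVec (hptop : p ≠ ∞) (hproj : ∀ x, P (P x) = P x)
    (hpos : IsPositiveOp P) (hcontr : ∀ x, ‖P x‖ ≤ ‖x‖) {α : ℝ} (hα : 0 < α)
    (hdiag : ∀ a, P (unitVec p a) a = α) :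
    ∃ (r : Setoid A) (D : A → Finset A), (∀ a b, a ∈ D b ↔ r a b) ∧
      (∀ a, ((D a).card : ℝ) = 1 / α) ∧ ∀ a, P (unitVec p a) = α • charFun p (D a) := by
  classical
  have hp1 : 1 ≤ p.toReal := by simpa using ENNReal.toReal_mono hptop (Fact.out : 1 ≤ p)
  have hp : 0 < p.toReal := one_pos.trans_le hp1
  have hnn : ∀ a b, 0 ≤ P (unitVec p b) a := fun a b => hpos _ (unitVec_nonneg b) a
  have hmul : ∀ a b, 0 < P (unitVec p b) a → P (unitVec p b) a * P (unitVec p a) b = α * α := by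
    intro a b hab
    rw [apply_unitVec_mul_apply_unitVec hp hproj hpos hcontr hab, hdiag, hdiag]
  have hsymm : ∀ {a b}, 0 < P (unitVec p b) a → 0 < P (unitVec p a) b := by
    intro a b hab
    refine (hnn b a).lt_of_ne fun h0 => ?_
    have := hmul a b hab
    rw [← h0, mul_zero] at this
    exact (mul_pos hα hα).ne this
  have htrans : ∀ {a b c}, 0 < P (unitVec p b) a → 0 < P (unitVec p c) b →
      0 < P (unitVec p c) a := by
    intro a b c hab hbc
    have hle := hpos.sum_mul_le_apply (hpos _ (unitVec_nonneg c)) {b} a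
    rw [Finset.sum_singleton, hproj] at hle
    exact (mul_pos hbc hab).trans_le hle
  let r : Setoid A :=
    ⟨fun a b => 0 < P (unitVec p b) a, fun a => by rw [hdiag]; exact hα, hsymm, htrans⟩
  let D : A → Finset A := fun b =>
    (finite_support_column hp hproj hpos hcontr hα hdiag b).toFinset
  have hD : ∀ a b, a ∈ D b ↔ 0 < P (unitVec p b) a := fun a b => by simp [D]
  have hzero : ∀ a b, a ∉ D b → P (unitVec p b) a = 0 := fun a b hab =>
    ((hnn a b).antisymm (not_lt.1 (mt (hD a b).2 hab))).symm
  have hcard : ∀ b, ((D b).card : ℝ) * α = 1 := by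
    intro b
    have h := apply_eq_sum_mul P (fun a ha => hzero a b ha) b
    rw [hproj, hdiag, Finset.sum_congr rfl fun a ha => hmul a b ((hD a b).1 ha),
      Finset.sum_const, nsmul_eq_mul] at h
    have : α * (((D b).card : ℝ) * α) = α * 1 := by linarith
    exact mul_left_cancel₀ hα.ne' this
  have hpair : ∀ b, ∀ a ∈ D b, ∀ c ∈ D b, 0 < P (unitVec p c) a := fun b a ha c hc =>
    htrans ((hD a b).1 ha) (hsymm ((hD c b).1 hc))
  -- The row sums `w` over a class `D b` satisfy `∑ w ^ p ≤ |D b|`, hence `∑ w ≤ |D b|`.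
  have hrow : ∀ b, ∑ a ∈ D b, ∑ c ∈ D b, P (unitVec p c) a ≤ (D b).card := by
    intro b
    have happ : ∀ a, P (charFun p (D b)) a = ∑ c ∈ D b, P (unitVec p c) a := by
      intro a
      rw [charFun, map_sum, lp.coeFn_sum, Finset.sum_apply]
    have hw : ∀ a, 0 ≤ P (charFun p (D b)) a := hpos _ (charFun_nonneg _)
    have h₁ : ∑ a ∈ D b, ‖P (charFun p (D b)) a‖ ^ p.toReal ≤ (D b).card := by
      rw [← norm_charFun_rpow hp]
      refine (sum_le_hasSum _ (fun _ _ => by positivity) (lp.hasSum_norm hp _)).trans ?_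
      exact Real.rpow_le_rpow (norm_nonneg _) (hcontr _) hp.le
    -- Bernoulli's inequality `w ^ p ≥ 1 + p (w - 1)` turns the bound on `p`-th powers into one on
    -- the row sums.
    have h₂ : ∑ a ∈ D b, (1 + p.toReal * (P (charFun p (D b)) a - 1)) ≤
        ∑ a ∈ D b, ‖P (charFun p (D b)) a‖ ^ p.toReal := by
      refine Finset.sum_le_sum fun a _ => ?_
      have := one_add_mul_self_le_rpow_one_add
        (show -1 ≤ P (charFun p (D b)) a - 1 by linarith [hw a]) hp1
      rw [Real.norm_of_nonneg (hw a)]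
      rwa [add_sub_cancel] at this
    have h₃ := h₂.trans h₁
    rw [Finset.sum_add_distrib, ← Finset.mul_sum, Finset.sum_sub_distrib] at h₃
    simp only [Finset.sum_const, nsmul_eq_mul, mul_one, happ] at h₃
    by_contra! hlt
    nlinarith
  have hentry : ∀ b, ∀ a ∈ D b, P (unitVec p b) a = α := by
    intro b a ha
    have hsq : ∀ x y : ℝ, 0 < x → x * y = α * α → 0 ≤ x + y - 2 * α := by
      intro x y hx hxy
      have hy : 0 < y := pos_of_mul_pos_right (hxy ▸ mul_pos hα hα) hx.le
      nlinarith [sq_nonneg (x - y)]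
    have hterm : ∀ a ∈ D b, ∀ c ∈ D b,
        0 ≤ P (unitVec p c) a + P (unitVec p a) c - 2 * α := fun a ha c hc =>
      hsq _ _ (hpair b a ha c hc) (hmul a c (hpair b a ha c hc))
    -- Transposed entries have equal total, so this sum is at most `2 |D b| - 2 α |D b|² = 0`; its
    -- nonnegative terms therefore all vanish.
    have hsum : ∑ a ∈ D b, ∑ c ∈ D b,
        (P (unitVec p c) a + P (unitVec p a) c - 2 * α) ≤ 0 := by
      simp only [Finset.sum_sub_distrib, Finset.sum_add_distrib, Finset.sum_const, nsmul_eq_mul]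
      rw [Finset.sum_comm (f := fun a c => P (unitVec p a) c)]
      have h₁ := hrow b
      have h₂ : ((D b).card : ℝ) * ((D b).card * (2 * α)) = 2 * (D b).card := by
        linear_combination 2 * ((D b).card : ℝ) * hcard b
      linarith
    have hb : b ∈ D b := (hD b b).2 (by rw [hdiag]; exact hα)
    have hz := (Finset.sum_eq_zero_iff_of_nonneg fun a ha => Finset.sum_nonneg (hterm a ha)).1
      (hsum.antisymm (Finset.sum_nonneg fun a ha => Finset.sum_nonneg (hterm a ha))) a ha
    have hz' := (Finset.sum_eq_zero_iff_of_nonneg (hterm a ha)).1 hz b hb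
    have hm := hmul a b (hpair b a ha b hb)
    have : (P (unitVec p b) a - α) ^ 2 = 0 := by
      linear_combination P (unitVec p b) a * hz' - hm
    linarith [pow_eq_zero_iff two_ne_zero |>.1 this]
  refine ⟨r, D, hD, fun a => eq_div_of_mul_eq hα.ne' (hcard a), fun b => ?_⟩
  refine lp.ext (funext fun a => ?_)
  rw [lp.coeFn_smul, Pi.smul_apply, charFun_apply]
  split_ifs with ha
  · simpa using hentry b a ha
  · simpa using hzero a b ha

/-- The expansion of a contraction with block structure along the blocks. -/
theorem hasSum_blocks (hptop : p ≠ ∞) (hcontr : ∀ x, ‖P x‖ ≤ ‖x‖) {α : ℝ} {r : Setoid A}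
    {D : A → Finset A} (hD : ∀ a b, a ∈ D b ↔ r a b)
    (hP : ∀ a, P (unitVec p a) = α • charFun p (D a)) (x : ellp A p) :
    HasSum (fun B : Set.range D => α • (∑ a ∈ B.1, x a) • charFun p B.1) (P x) := by
  classical
  have hDeq : ∀ {a b}, a ∈ D b ↔ D a = D b := by
    intro a b
    refine ⟨fun h => ?_, fun h => h ▸ (hD a a).2 (r.refl a)⟩
    ext c
    rw [hD] at h
    rw [hD, hD]
    exact ⟨fun hc => r.trans hc h, fun hc => r.trans hc (r.symm h)⟩
  let Pc : ellp A p →L[ℝ] ellp A p := P.mkContinuous 1 fun x => by simpa using hcontr x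
  have h₁ : HasSum (fun a => x a • P (unitVec p a)) (P x) := by
    have h : HasSum _ (P x) := (lp.hasSum_single hptop x).mapL Pc
    convert h using 2 with a
    change x a • P (unitVec p a) = P (lp.single p a (x a))
    rw [← map_smul]
    congr 1
    refine lp.ext (funext fun b => ?_)
    rw [lp.coeFn_smul, Pi.smul_apply, unitVec_apply, lp.single_apply, Pi.single_apply]
    split_ifs <;> simp
  -- The column expansion is regrouped along the fibres of `π`, which are the blocks.
  let π : A → Set.range D := fun a => ⟨D a, a, rfl⟩
  have h₂ := (Equiv.sigmaFiberEquiv π).hasSum_iff.2 h₁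
  refine h₂.sigma fun B => ?_
  obtain ⟨B, b, rfl⟩ := B
  let φ : D b ≃ {a // π a = ⟨D b, b, rfl⟩} :=
    Equiv.subtypeEquivRight fun a => hDeq.trans
      (Subtype.ext_iff (a1 := π a) (a2 := ⟨D b, b, rfl⟩)).symm
  rw [← φ.hasSum_iff]
  convert hasSum_fintype _ using 1
  change _ = ∑ a : D b, x a • P (unitVec p a)
  rw [Finset.sum_coe_sort (D b) fun a => x a • P (unitVec p a), smul_comm, Finset.sum_smul]
  refine Finset.sum_congr rfl fun a ha => ?_
  rw [hP, hDeq.1 ha]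

end Projection

/-! ### Enumerations adapted to the blocks -/

section Enumeration

variable {A : Type*}

/-- If all classes of an equivalence relation have `n` elements, the set is the product of its
quotient with `Fin n`. -/
theorem exists_equiv_quotient_prod_fin (r : Setoid A) (D : A → Finset A)
    (hD : ∀ a b, a ∈ D b ↔ r a b) {n : ℕ} (hn : ∀ a, (D a).card = n) :
    ∃ g : A ≃ Quotient r × Fin n, ∀ a, (g a).1 = Quotient.mk r a := by
  have hfib : ∀ q : Quotient r, Nonempty ({a // Quotient.mk r a = q} ≃ Fin n) := by
    intro q
    induction q using Quotient.inductionOn with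
    | _ b =>
      refine ⟨(Equiv.subtypeEquivRight fun a => ?_).trans ((D b).equivFinOfCardEq (hn b))⟩
      rw [hD, Quotient.eq]
  let φ := fun q => (hfib q).some
  exact ⟨(Equiv.sigmaFiberEquiv (Quotient.mk r)).symm.trans
    ((Equiv.sigmaCongrRight φ).trans (Equiv.sigmaEquivProd _ _)), fun _ => rfl⟩

/-- Classes are laid out one after another: `j / n` selects the class and `j % n` the position
inside it. -/
theorem exists_nat_equiv_div_eq_iff [Countable A] [Infinite A] (r : Setoid A) (D : A → Finset A)
    (hD : ∀ a b, a ∈ D b ↔ r a b) {n : ℕ} (hn0 : 0 < n) (hn : ∀ a, (D a).card = n) :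
    ∃ e : ℕ ≃ A, ∀ j k, r (e j) (e k) ↔ j / n = k / n := by
  obtain ⟨g, hg⟩ := exists_equiv_quotient_prod_fin r D hD hn
  have : NeZero n := ⟨hn0.ne'⟩
  have : Infinite (Quotient r) := by
    by_contra hfin
    have := not_infinite_iff_finite.1 hfin
    exact not_finite_iff_infinite.2 ‹Infinite A› (Finite.of_equiv _ g.symm)
  obtain ⟨f⟩ := nonempty_equiv_of_countable (α := ℕ) (β := Quotient r)
  let e : ℕ ≃ A := (Nat.divModEquiv n).trans ((f.prodCongr (Equiv.refl _)).trans g.symm)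
  have he : ∀ j, Quotient.mk r (e j) = f (j / n) := by
    intro j
    rw [← hg]
    simp [e]
  refine ⟨e, fun j k => ?_⟩
  rw [← Quotient.eq (r := r), he, he, f.injective.eq_iff]

theorem exists_fin_equiv_div_eq_iff [Finite A] (r : Setoid A) (D : A → Finset A)
    (hD : ∀ a b, a ∈ D b ↔ r a b) {n : ℕ} (hn : ∀ a, (D a).card = n) :
    ∃ (m : ℕ) (e : Fin (m * n) ≃ A), ∀ j k, r (e j) (e k) ↔ (j : ℕ) / n = (k : ℕ) / n := by
  obtain ⟨g, hg⟩ := exists_equiv_quotient_prod_fin r D hD hn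
  obtain ⟨m, ⟨f⟩⟩ := Finite.exists_equiv_fin (Quotient r)
  let e : Fin (m * n) ≃ A :=
    finProdFinEquiv.symm.trans ((f.symm.prodCongr (Equiv.refl _)).trans g.symm)
  have he : ∀ j, Quotient.mk r (e j) = f.symm j.divNat := by
    intro j
    rw [← hg]
    simp [e]
  refine ⟨m, e, fun j k => ?_⟩
  rw [← Quotient.eq (r := r), he, he, f.symm.injective.eq_iff, Fin.ext_iff, Fin.coe_divNat,
    Fin.coe_divNat]

end Enumeration

end PosProj

theorem mainTheorem3 {A : Type*} [Nonempty A] (p : ℝ≥0∞) [Fact (1 ≤ p)] (hp : p ≠ ∞)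
    (P : PosProj.ellp A p →ₗ[ℝ] PosProj.ellp A p)
    (hproj : ∀ x, P (P x) = P x)
    (hpos : PosProj.IsPositiveOp P)
    (hcontr : ∀ x, ‖P x‖ ≤ ‖x‖)
    (α : ℝ) (hα : 0 < α) (hdiag : PosProj.HasConstantDiagonal P α) :
    ∃ n : ℕ, (n : ℝ) = 1 / α ∧
      -- the partition into blocks of size `n` and the formula for `P` (convergence in `ℓ_p` norm)
      (∃ 𝒜 : Set (Finset A),
        Setoid.IsPartition ((fun B : Finset A => (B : Set A)) '' 𝒜) ∧
        (∀ B ∈ 𝒜, B.card = n) ∧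
        ∀ x : PosProj.ellp A p,
          HasSum (fun B : 𝒜 => α • (∑ a ∈ B.1, x a) • PosProj.charFun p B.1) (P x)) ∧
      -- the matrix of `P` when `A` is countably infinite
      (Countable A → Infinite A → ∃ e : ℕ ≃ A,
        PosProj.matrixOf P e = Matrix.of fun (j k : ℕ) => if j / n = k / n then α else 0) ∧
      -- the matrix of `P` when `A` is finite
      (Finite A → ∃ (m : ℕ) (e : Fin (m * n) ≃ A),
        PosProj.matrixOf P e =
          Matrix.of fun (j k : Fin (m * n)) => if (j : ℕ) / n = (k : ℕ) / n then α else 0) := by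
  classical
  obtain ⟨r, D, hD, hcard, hP⟩ := PosProj.exists_setoid_apply_unitVec hp hproj hpos hcontr hα
    hdiag.apply_unitVec_self
  obtain ⟨a₀⟩ := ‹Nonempty A›
  have hn : ∀ a, (D a).card = (D a₀).card := fun a => by
    exact_mod_cast (hcard a).trans (hcard a₀).symm
  have hself : ∀ a, a ∈ D a := fun a => (hD a a).2 (r.refl a)
  have hn0 : 0 < (D a₀).card := Finset.card_pos.2 ⟨a₀, hself a₀⟩
  have hentry : ∀ a b, P (PosProj.unitVec p b) a = if r a b then α else 0 := by
    intro a b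
    rw [hP, lp.coeFn_smul, Pi.smul_apply, PosProj.charFun_apply]
    simp only [hD, smul_eq_mul, mul_ite, mul_one, mul_zero]
  refine ⟨(D a₀).card, hcard a₀, ⟨Set.range D, ⟨?_, fun a => ?_⟩, ?_,
    PosProj.hasSum_blocks hp hcontr hD hP⟩, fun _ _ => ?_, fun _ => ?_⟩
  · rintro ⟨_, ⟨b, rfl⟩, hb⟩
    exact Finset.notMem_empty b (Finset.coe_eq_empty.1 hb ▸ hself b)
  · refine ⟨D a, ⟨⟨_, ⟨a, rfl⟩, rfl⟩, hself a⟩, ?_⟩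
    rintro _ ⟨⟨_, ⟨b, rfl⟩, rfl⟩, hab⟩
    have hab' : r a b := (hD a b).1 hab
    ext c
    change c ∈ D b ↔ c ∈ D a
    rw [hD, hD]
    exact ⟨fun hc => r.trans hc (r.symm hab'), fun hc => r.trans hc hab'⟩
  · rintro _ ⟨b, rfl⟩
    exact hn b
  · obtain ⟨e, he⟩ := PosProj.exists_nat_equiv_div_eq_iff r D hD hn0 hn
    refine ⟨e, Matrix.ext fun j k => ?_⟩
    simp only [PosProj.matrixOf, Matrix.of_apply, hentry, he]
  · obtain ⟨m, e, he⟩ := PosProj.exists_fin_equiv_div_eq_iff r D hD hn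
    refine ⟨m, e, Matrix.ext fun j k => ?_⟩
    simp only [PosProj.matrixOf, Matrix.of_apply, hentry, he]
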